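/- For real $q$ with $|q|<1$ put $[n]_q=1+q+\dots+q^{n-1}$ (so $[0]_q=0$), $[n]_q!=\prod_{j=1}^n[j]_q$, $(a)_n=\prod_{j=0}^{n-1}(1-aq^j)$ and $S(q)=\left[-\frac{2}{\sqrt{1-q}},\frac{2}{\sqrt{1-q}}\right]$. For real $x,y,\rho$ let $P_n(x|y,\rho,q)$ be the rescaled Al-Salam–Chihara polynomials, defined by $P_{-1}=0$, $P_0=1$ and $$P_{n+1}(x|y,\rho,q)=(x-\rho yq^n)P_n(x|y,\rho,q)-(1-\rho^2q^{n-1})[n]_qP_{n-1}(x|y,\rho,q),\qquad n\ge 0.$$ **Theorem (reciprocal of the Al-Salam–Chihara kernel).** Let $q,\rho_1,\rho_2$ be real with $|q|,|\rho_1|,|\rho_2|<1$ and $\rho_1,\rho_2\neq 0$, and let $x,y,z\in S(q)$. Then both series below converge absolutely, the sum of the series on the left-hand side is strictly positive, and $$1\Big/\sum_{n\ge 0}\frac{\rho_1^n}{[n]_q!\,(\rho_2^2)_n}P_n(x|y,\rho_2,q)\,P_n\!\left(z\Big|y,\frac{\rho_2}{\rho_1},q\right)=\sum_{n\ge 0}\frac{\rho_2^n}{[n]_q!\,(\rho_1^2)_n}P_n(x|z,\rho_1,q)\,P_n\!\left(y\Big|z,\frac{\rho_1}{\rho_2},q\right).$$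 -/

import Mathlib

namespace ASC

/-- The `q`-number `[n]_q = 1 + q + ⋯ + q^(n-1)`, with `[0]_q = 0`. -/
def qNumber (q : ℝ) (n : ℕ) : ℝ :=
  ∑ j ∈ Finset.range n, q ^ j

/-- The `q`-factorial `[n]_q! = [1]_q [2]_q ⋯ [n]_q`, with `[0]_q! = 1`. -/
def qFactorial (q : ℝ) (n : ℕ) : ℝ :=
  ∏ j ∈ Finset.range n, qNumber q (j + 1)

/-- The `q`-Pochhammer symbol `(a)_n = (a; q)_n = (1 - a) (1 - a q) ⋯ (1 - a q^(n-1))`. -/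
def qPochhammer (a q : ℝ) (n : ℕ) : ℝ :=
  ∏ j ∈ Finset.range n, (1 - a * q ^ j)

/-- The rescaled Al-Salam–Chihara polynomials `P_n(x|y,ρ,q)`, with `P_{-1} = 0`, `P_0 = 1` and
`P_{n+1} = (x - ρ y q^n) P_n - (1 - ρ² q^(n-1)) [n]_q P_{n-1}`. -/
def P (x y ρ q : ℝ) : ℕ → ℝ
  | 0 => 1
  | 1 => x - ρ * y
  | n + 2 => (x - ρ * y * q ^ (n + 1)) * P x y ρ q (n + 1)
      - (1 - ρ ^ 2 * q ^ n) * qNumber q (n + 1) * P x y ρ q n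

/-- The interval `S(q) = [-2/√(1-q), 2/√(1-q)]`. -/
noncomputable def S (q : ℝ) : Set ℝ :=
  Set.Icc (-(2 / √(1 - q))) (2 / √(1 - q))

end ASC

open Filter Topology Asymptotics Finset

namespace ASC

/-! ### Growth of solutions of perturbed recurrences -/

/-! Let M(x,y;r) = Σ r^i H_i(x) H_i(y) / [i]_q! be the Poisson–Mehler sum of the q-Hermite
polynomials (`mehlerSum` without shifts). The left-hand series equals M(x,z;ρ₁) / M(x,y;ρ₂)
(`hasSum_kernel`), and exchanging (ρ₁, y) with (ρ₂, z) inverts this quotient.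

The quotient arises from summing one double series in two ways: along rows,
`qPochhammer_mul_mehlerSum` produces the kernel times M(x,y;ρ₂); along antidiagonals,
`sum_antidiagonal_homP_mul_qHermite` collapses it to M(x,z;ρ₁). Growth bounds read off from the
three-term recurrences justify the interchange.

Positivity needs no product formula: M is continuous in r, equals 1 at r = 0, and a zero at r would
force zeros at all r q^k, which tend to 0 (`mehlerSum_ne_zero`). -/

lemma isBigO_pow_of_eventually_le {u : ℕ → ℝ} {s : ℝ} (hs : 0 < s) (hu : ∀ n, 0 ≤ u n)
    (h : ∀ᶠ n in atTop, u (n + 1) ≤ s * u n) : u =O[atTop] fun n => s ^ n := by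
  obtain ⟨N, hN⟩ := eventually_atTop.1 h
  refine IsBigO.of_bound (u N / s ^ N) (eventually_atTop.2 ⟨N, fun n hn => ?_⟩)
  rw [Real.norm_of_nonneg (hu n), Real.norm_of_nonneg (by positivity)]
  induction n, hn using Nat.le_induction with
  | base => rw [div_mul_cancel₀ _ (by positivity)]
  | succ n hn ih =>
    calc u (n + 1) ≤ s * u n := hN n hn
      _ ≤ s * (u N / s ^ N * s ^ n) := by gcongr
      _ = u N / s ^ N * s ^ (n + 1) := by ring

lemma isBigO_pow_of_ratio_tendsto {u r : ℕ → ℝ} {l s : ℝ} (hl : |l| < s)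
    (hr : Tendsto r atTop (𝓝 l)) (hu : ∀ n, u (n + 1) = r n * u n) :
    u =O[atTop] fun n => s ^ n := by
  refine IsBigO.of_norm_left (isBigO_pow_of_eventually_le ((abs_nonneg l).trans_lt hl)
    (fun n => norm_nonneg _) ?_)
  filter_upwards [hr.abs.eventually (gt_mem_nhds hl)] with n hn
  rw [hu, norm_mul]
  exact mul_le_mul_of_nonneg_right hn.le (norm_nonneg _)

/-- A solution of a perturbation of the recurrence with characteristic roots `l e^{±iθ}`,
`c = cos θ`, grows at most like `s ^ n` for every `s > |l|`. -/
lemma isBigO_pow_of_recurrence {u α β : ℕ → ℝ} {c l s : ℝ} (hc : |c| ≤ 1) (hl : |l| < s)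
    (hα : Tendsto α atTop (𝓝 (2 * c * l))) (hβ : Tendsto β atTop (𝓝 (l ^ 2)))
    (hu : ∀ n, u (n + 2) = α n * u (n + 1) - β n * u n) :
    u =O[atTop] fun n => s ^ n := by
  have hs : 0 < s := (abs_nonneg l).trans_lt hl
  obtain ⟨hc1, hc2⟩ := abs_le.1 hc
  -- Take e = e^{iθ} with cos θ = c. Removing the root l e from the recurrence leaves a perturbed
  -- first-order recurrence for `v`, whose multiplier l(2c - e) has modulus |l|.
  obtain ⟨e, he, hec⟩ : ∃ e : ℂ, ‖e‖ = 1 ∧ e ^ 2 = 2 * c * e - 1 := by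
    refine ⟨Complex.exp (Real.arccos c * Complex.I), Complex.norm_exp_ofReal_mul_I _, ?_⟩
    rw [Complex.exp_mul_I, ← Complex.ofReal_cos, ← Complex.ofReal_sin, Real.cos_arccos hc1 hc2]
    have h1 : ((Real.sin (Real.arccos c) : ℝ) : ℂ) ^ 2 = 1 - (c : ℂ) ^ 2 := by
      have := Real.sin_sq_add_cos_sq (Real.arccos c)
      rw [Real.cos_arccos hc1 hc2] at this
      exact_mod_cast eq_sub_of_add_eq this
    linear_combination (Complex.I ^ 2) * h1 + (1 - (c : ℂ) ^ 2) * Complex.I_sq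
  set v : ℕ → ℂ := fun n => u (n + 1) - l * e * u n with hv
  have hv1 : ∀ n, v (n + 1) = l * (2 * c - e) * v n
      + ((α n - 2 * c * l : ℝ) : ℂ) * u (n + 1) - ((β n - l ^ 2 : ℝ) : ℂ) * u n := fun n => by
    simp only [hv, hu n]
    push_cast
    linear_combination (-(l : ℂ) ^ 2 * u n) * hec
  have he' : ‖(2 * c - e : ℂ)‖ = 1 := by
    have h1 : e * (2 * c - e) = 1 := by linear_combination -hec
    have h2 := congrArg norm h1
    rwa [norm_mul, he, one_mul, norm_one] at h2
  set δ : ℝ := (s - |l|) / 2 with hδ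
  have hδ0 : 0 < δ := by rw [hδ]; linarith
  -- The two bounds on ε make ‖v‖ + δ|u| grow by at most a factor s: the first controls the
  -- coefficient of ‖v‖, the second that of |u|.
  obtain ⟨ε, hε0, hε1, hε2⟩ : ∃ ε : ℝ, 0 < ε ∧ ε ≤ δ ∧ ε * (|l| + 1) ≤ δ * (s - |l|) := by
    have h1 : 0 < |l| + 1 := by positivity
    refine ⟨min δ (δ * (s - |l|) / (|l| + 1)), ?_, min_le_left _ _, ?_⟩
    · exact lt_min hδ0 (div_pos (mul_pos hδ0 (by linarith)) h1)
    · rw [← le_div_iff₀ h1]; exact min_le_right _ _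
  have hN : (fun n => ‖v n‖ + δ * |u n|) =O[atTop] fun n => s ^ n := by
    refine isBigO_pow_of_eventually_le hs (fun n => by positivity) ?_
    filter_upwards [(tendsto_iff_norm_sub_tendsto_zero.1 hα).eventually (gt_mem_nhds hε0),
      (tendsto_iff_norm_sub_tendsto_zero.1 hβ).eventually (gt_mem_nhds hε0)] with n h1 h2
    have h3 : ‖v (n + 1)‖ ≤ |l| * ‖v n‖ + ε * |u (n + 1)| + ε * |u n| := by
      rw [hv1]
      refine (norm_sub_le _ _).trans (add_le_add ((norm_add_le _ _).trans (add_le_add ?_ ?_)) ?_)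
      · rw [norm_mul, norm_mul, he', mul_one, Complex.norm_real, Real.norm_eq_abs]
      · rw [norm_mul, Complex.norm_real, Complex.norm_real, Real.norm_eq_abs (u _)]
        exact mul_le_mul_of_nonneg_right h1.le (abs_nonneg _)
      · rw [norm_mul, Complex.norm_real, Complex.norm_real, Real.norm_eq_abs (u _)]
        exact mul_le_mul_of_nonneg_right h2.le (abs_nonneg _)
    have h4 : |u (n + 1)| ≤ ‖v n‖ + |l| * |u n| := by
      have h5 : ((u (n + 1) : ℝ) : ℂ) = v n + l * e * u n := by simp [hv]
      have h6 := norm_add_le (v n) (l * e * u n)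
      rwa [← h5, norm_mul, norm_mul, he, mul_one, Complex.norm_real, Complex.norm_real,
        Complex.norm_real] at h6
    have h7 : (ε + δ) * |u (n + 1)| ≤ (ε + δ) * (‖v n‖ + |l| * |u n|) := by gcongr
    have h8 : (ε + δ) * ‖v n‖ ≤ (s - |l|) * ‖v n‖ := by
      gcongr
      linarith
    have h9 : ε * (|l| + 1) * |u n| ≤ δ * (s - |l|) * |u n| := by gcongr
    nlinarith
  refine (IsBigO.of_bound (1 / δ) (Eventually.of_forall fun n => ?_)).trans hN
  rw [Real.norm_of_nonneg (by positivity : 0 ≤ ‖v n‖ + δ * |u n|), div_mul_eq_mul_div,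
    le_div_iff₀ hδ0, Real.norm_eq_abs]
  linarith [norm_nonneg (v n)]

/-! ### `q`-numbers -/

lemma qNumber_zero (q : ℝ) : qNumber q 0 = 0 := by simp [qNumber]

lemma qNumber_one (q : ℝ) : qNumber q 1 = 1 := by simp [qNumber]

lemma qNumber_add (q : ℝ) (n i : ℕ) : qNumber q (n + i) = qNumber q n + q ^ n * qNumber q i := by
  simp only [qNumber, sum_range_add, pow_add, mul_sum]

lemma one_sub_mul_qNumber (q : ℝ) (n : ℕ) : (1 - q) * qNumber q n = 1 - q ^ n :=
  mul_neg_geom_sum q n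

lemma abs_mul_pow_lt_one {a q : ℝ} (ha : |a| < 1) (hq : |q| < 1) (n : ℕ) : |a * q ^ n| < 1 := by
  rw [abs_mul, abs_pow]
  exact (mul_le_of_le_one_right (abs_nonneg a)
    (pow_le_one₀ (abs_nonneg q) hq.le)).trans_lt ha

lemma qNumber_succ_pos {q : ℝ} (hq : |q| < 1) (n : ℕ) : 0 < qNumber q (n + 1) := by
  have h1 := one_sub_mul_qNumber q (n + 1)
  have h2 := (abs_lt.1 (abs_mul_pow_lt_one hq hq n)).2
  have h3 := (abs_lt.1 hq).2
  rw [pow_succ'] at h1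
  by_contra h
  nlinarith

lemma tendsto_qNumber {q : ℝ} (hq : |q| < 1) :
    Tendsto (qNumber q) atTop (𝓝 (1 - q)⁻¹) :=
  (hasSum_geometric_of_abs_lt_one hq).tendsto_sum_nat

lemma qFactorial_zero (q : ℝ) : qFactorial q 0 = 1 := by simp [qFactorial]

lemma qFactorial_succ (q : ℝ) (n : ℕ) :
    qFactorial q (n + 1) = qFactorial q n * qNumber q (n + 1) := prod_range_succ _ _

lemma qFactorial_ne_zero {q : ℝ} (hq : |q| < 1) (n : ℕ) : qFactorial q n ≠ 0 :=
  prod_ne_zero_iff.2 fun j _ => (qNumber_succ_pos hq j).ne'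

lemma qPochhammer_succ (a q : ℝ) (n : ℕ) :
    qPochhammer a q (n + 1) = qPochhammer a q n * (1 - a * q ^ n) := prod_range_succ _ _

lemma one_sub_mul_pow_ne_zero {a q : ℝ} (ha : |a| < 1) (hq : |q| < 1) (n : ℕ) :
    1 - a * q ^ n ≠ 0 := by
  have := (abs_lt.1 (abs_mul_pow_lt_one ha hq n)).2
  linarith

lemma qPochhammer_ne_zero {a q : ℝ} (ha : |a| < 1) (hq : |q| < 1) (n : ℕ) :
    qPochhammer a q n ≠ 0 :=
  prod_ne_zero_iff.2 fun j _ => one_sub_mul_pow_ne_zero ha hq j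

lemma isBigO_inv_qFactorial {q s : ℝ} (hq : |q| < 1) (hs : 1 - q < s) :
    (fun n => (qFactorial q n)⁻¹) =O[atTop] fun n => s ^ n := by
  have h1 : 0 < 1 - q := by linarith [(abs_lt.1 hq).2]
  refine isBigO_pow_of_ratio_tendsto (l := 1 - q) (r := fun n => (qNumber q (n + 1))⁻¹)
    (by rwa [abs_of_pos h1]) ?_ fun n => ?_
  · simpa using ((tendsto_qNumber hq).comp (tendsto_add_atTop_nat 1)).inv₀ (inv_ne_zero h1.ne')
  · rw [qFactorial_succ, mul_inv, mul_comm]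

/-! ### Polynomials -/

/-- The homogeneous form `a ^ n * P_n(x|y, b / a, q)` of the Al-Salam–Chihara polynomials. -/
def homP (x y a b q : ℝ) : ℕ → ℝ
  | 0 => 1
  | 1 => a * x - b * y
  | n + 2 => (a * x - b * y * q ^ (n + 1)) * homP x y a b q (n + 1)
      - (a ^ 2 - b ^ 2 * q ^ n) * qNumber q (n + 1) * homP x y a b q n

/-- The continuous `q`-Hermite polynomials. -/
def qHermite (x q : ℝ) : ℕ → ℝ
  | 0 => 1
  | 1 => x
  | n + 2 => x * qHermite x q (n + 1) - qNumber q (n + 1) * qHermite x q n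

lemma homP_one_left (x y b q : ℝ) : ∀ n, homP x y 1 b q n = P x y b q n
  | 0 => rfl
  | 1 => by simp [homP, P]
  | n + 2 => by
    rw [homP, P, homP_one_left x y b q n, homP_one_left x y b q (n + 1)]
    ring

lemma homP_eq_pow_mul {a : ℝ} (ha : a ≠ 0) (x y b q : ℝ) :
    ∀ n, homP x y a b q n = a ^ n * P x y (b / a) q n
  | 0 => by simp [homP, P]
  | 1 => by
    simp only [homP, P]
    field_simp
  | n + 2 => by
    rw [homP, P, homP_eq_pow_mul ha x y b q n, homP_eq_pow_mul ha x y b q (n + 1)]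
    field_simp
    ring

lemma homP_one_zero (x y q : ℝ) : ∀ n, homP x y 1 0 q n = qHermite x q n
  | 0 => rfl
  | 1 => by simp [homP, qHermite]
  | n + 2 => by
    rw [homP, qHermite, homP_one_zero x y q n, homP_one_zero x y q (n + 1)]
    ring

/-- The three-term recurrence, uniform in `n` because `[0]_q = 0`. -/
lemma qHermite_succ (x q : ℝ) :
    ∀ n, qHermite x q (n + 1) = x * qHermite x q n - qNumber q n * qHermite x q (n - 1)
  | 0 => by simp [qHermite, qNumber_zero]
  | _ + 1 => rfl

/-- The limiting recurrence has roots (a/√(1-q)) e^{±iθ} with cos θ = x√(1-q)/2; membership in S(q)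
is exactly |cos θ| ≤ 1. No bound on b is needed, since b enters only through terms that vanish in
the limit. -/
lemma isBigO_homP {q x a s : ℝ} (hq : |q| < 1) (hx : x ∈ S q) (y b : ℝ) (hs : |a| < s) :
    homP x y a b q =O[atTop] fun n => (s / √(1 - q)) ^ n := by
  have h1 : 0 < 1 - q := by linarith [(abs_lt.1 hq).2]
  have h2 : 0 < √(1 - q) := Real.sqrt_pos.2 h1
  have hx' : |x| ≤ 2 / √(1 - q) := abs_le.2 hx
  have hq0 := tendsto_pow_atTop_nhds_zero_of_abs_lt_one hq
  refine isBigO_pow_of_recurrence (c := x * √(1 - q) / 2) (l := a / √(1 - q))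
    (α := fun n => a * x - b * y * q ^ (n + 1))
    (β := fun n => (a ^ 2 - b ^ 2 * q ^ n) * qNumber q (n + 1)) ?_ ?_ ?_ ?_ fun n => rfl
  · rw [le_div_iff₀ h2] at hx'
    rw [abs_div, abs_mul, abs_of_pos h2, abs_two]
    linarith
  · rw [abs_div, abs_of_pos h2]
    gcongr
  · have h3 : 2 * (x * √(1 - q) / 2) * (a / √(1 - q)) = a * x - b * y * 0 := by
      field_simp
      ring
    rw [h3]
    exact ((hq0.comp (tendsto_add_atTop_nat 1)).const_mul _).const_sub _
  · have h3 : (a / √(1 - q)) ^ 2 = (a ^ 2 - b ^ 2 * 0) * (1 - q)⁻¹ := by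
      rw [div_pow, Real.sq_sqrt h1.le]
      ring
    rw [h3]
    exact ((hq0.const_mul _).const_sub _).mul
      ((tendsto_qNumber hq).comp (tendsto_add_atTop_nat 1))

lemma isBigO_qHermite {q x s : ℝ} (hq : |q| < 1) (hx : x ∈ S q) (hs : 1 < s) :
    qHermite x q =O[atTop] fun n => (s / √(1 - q)) ^ n := by
  have h := isBigO_homP hq hx 0 0 (a := 1) (by rwa [abs_one])
  rwa [funext (homP_one_zero x 0 q)] at h

/-! ### Connection between the two families -/

/-- Expansion of the `q`-Hermite polynomials in Al-Salam–Chihara polynomials. -/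
lemma sum_antidiagonal_homP_mul_qHermite {q : ℝ} (hq : |q| < 1) (z y a b : ℝ) (N : ℕ) :
    ∑ p ∈ antidiagonal N, homP z y a b q p.1 / qFactorial q p.1 *
      (b ^ p.2 * qHermite y q p.2 / qFactorial q p.2) =
      a ^ N * qHermite z q N / qFactorial q N := by
  set r : ℕ → ℝ := fun n => homP z y a b q n / qFactorial q n with hr
  set g : ℕ → ℝ := fun n => b ^ n * qHermite y q n / qFactorial q n with hg
  have hF := fun n => qFactorial_ne_zero hq n
  have hn := fun n => (qNumber_succ_pos hq n).ne'
  have hr1 : qNumber q 1 * r 1 = (a * z - b * y) * r 0 := by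
    simp [hr, homP, qFactorial_succ, qFactorial_zero, qNumber_one]
  have hr2 : ∀ n, qNumber q (n + 2) * r (n + 2) =
      (a * z - b * y * q ^ (n + 1)) * r (n + 1) - (a ^ 2 - b ^ 2 * q ^ n) * r n := fun n => by
    have := hF n; have := hn n; have := hn (n + 1)
    simp only [hr, homP, qFactorial_succ q (n + 1), qFactorial_succ q n]
    field_simp
  have hg1 : qNumber q 1 * g 1 = b * y * g 0 := by
    simp [hg, qHermite, qFactorial_succ, qFactorial_zero, qNumber_one]
  have hg2 : ∀ n, qNumber q (n + 2) * g (n + 2) = b * y * g (n + 1) - b ^ 2 * g n := fun n => by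
    have := hF n; have := hn n; have := hn (n + 1)
    simp only [hg, qHermite, qFactorial_succ q (n + 1), qFactorial_succ q n]
    field_simp
    ring
  -- A q-Leibniz rule, from [i+j] = [i] + q^i [j].
  have hsplit : ∀ N, qNumber q (N + 1) * ∑ p ∈ antidiagonal (N + 1), r p.1 * g p.2 =
      ∑ p ∈ antidiagonal N, qNumber q (p.1 + 1) * r (p.1 + 1) * g p.2 +
      ∑ p ∈ antidiagonal N, q ^ p.1 * r p.1 * (qNumber q (p.2 + 1) * g (p.2 + 1)) := fun N => by
    have h1 : qNumber q (N + 1) * ∑ p ∈ antidiagonal (N + 1), r p.1 * g p.2 =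
        ∑ p ∈ antidiagonal (N + 1), qNumber q p.1 * r p.1 * g p.2 +
        ∑ p ∈ antidiagonal (N + 1), q ^ p.1 * r p.1 * (qNumber q p.2 * g p.2) := by
      rw [mul_sum, ← sum_add_distrib]
      refine sum_congr rfl fun p hp => ?_
      rw [← mem_antidiagonal.1 hp, qNumber_add]
      ring
    rw [h1, Finset.Nat.sum_antidiagonal_succ, Finset.Nat.sum_antidiagonal_succ' (n := N)]
    simp [qNumber_zero]
  have key : ∀ N, ∑ p ∈ antidiagonal N, r p.1 * g p.2 = a ^ N * qHermite z q N / qFactorial q N ∧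
      ∑ p ∈ antidiagonal (N + 1), r p.1 * g p.2 =
        a ^ (N + 1) * qHermite z q (N + 1) / qFactorial q (N + 1) := by
    intro N
    induction N with
    | zero =>
      have h0 := hsplit 0
      simp only [Finset.Nat.antidiagonal_zero, sum_singleton, zero_add, hr1, hg1, pow_zero] at h0
      rw [qNumber_one, one_mul] at h0
      constructor
      · simp [hr, hg, homP, qHermite, qFactorial_zero]
      · rw [zero_add, h0]
        simp [hr, hg, homP, qHermite, qFactorial_zero, qFactorial_succ, qNumber_one]
    | succ N ih =>
      refine ⟨ih.2, mul_left_cancel₀ (hn (N + 1)) ?_⟩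
      have h1 : ∑ p ∈ antidiagonal (N + 1), qNumber q (p.1 + 1) * r (p.1 + 1) * g p.2 =
          ∑ p ∈ antidiagonal (N + 1), (a * z - b * y * q ^ p.1) * r p.1 * g p.2 -
          ∑ p ∈ antidiagonal N, (a ^ 2 - b ^ 2 * q ^ p.1) * r p.1 * g p.2 := by
        rw [Finset.Nat.sum_antidiagonal_succ, Finset.Nat.sum_antidiagonal_succ, add_sub_assoc,
          ← sum_sub_distrib]
        congr 1
        · rw [zero_add, hr1, pow_zero, mul_one]
        · refine sum_congr rfl fun p _ => ?_
          rw [hr2]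
          ring
      have h2 : ∑ p ∈ antidiagonal (N + 1), q ^ p.1 * r p.1 * (qNumber q (p.2 + 1) * g (p.2 + 1)) =
          ∑ p ∈ antidiagonal (N + 1), b * y * q ^ p.1 * r p.1 * g p.2 -
          ∑ p ∈ antidiagonal N, b ^ 2 * q ^ p.1 * r p.1 * g p.2 := by
        rw [Finset.Nat.sum_antidiagonal_succ', Finset.Nat.sum_antidiagonal_succ', add_sub_assoc,
          ← sum_sub_distrib]
        congr 1
        · rw [zero_add, hg1]
          ring
        · refine sum_congr rfl fun p _ => ?_
          rw [hg2]
          ring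
      -- The q^i-dependent terms of the two halves cancel, leaving the q-Hermite recurrence in z.
      have h3 : qNumber q (N + 1 + 1) * ∑ p ∈ antidiagonal (N + 1 + 1), r p.1 * g p.2 =
          a * z * ∑ p ∈ antidiagonal (N + 1), r p.1 * g p.2 -
          a ^ 2 * ∑ p ∈ antidiagonal N, r p.1 * g p.2 := by
        rw [hsplit, h1, h2, mul_sum, mul_sum, sub_add_sub_comm, ← sum_add_distrib,
          ← sum_add_distrib]
        congr 1 <;> exact sum_congr rfl fun p _ => by ring
      rw [h3, ih.1, ih.2]
      have := hF N; have := hn N; have := hn (N + 1)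
      simp only [qHermite, qFactorial_succ q (N + 1), qFactorial_succ q N]
      field_simp
      ring
  exact (key N).1

/-! ### The shifted Poisson–Mehler sums -/

/-- The terms of the Poisson–Mehler series with shifted indices. -/
noncomputable def mehlerTerm (x y r q : ℝ) (n m i : ℕ) : ℝ :=
  r ^ i / qFactorial q i * qHermite x q (i + n) * qHermite y q (i + m)

/-- The Poisson–Mehler series with shifted indices. -/
noncomputable def mehlerSum (x y r q : ℝ) (n m : ℕ) : ℝ := ∑' i, mehlerTerm x y r q n m i

lemma exists_one_lt_mul_pow_lt_one {r : ℝ} (hr : r < 1) (k : ℕ) :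
    ∃ s : ℝ, 1 < s ∧ r * s ^ k < 1 := by
  have h1 : Tendsto (fun s : ℝ => r * s ^ k) (𝓝[>] 1) (𝓝 (r * 1 ^ k)) :=
    ((continuous_const.mul (continuous_pow k)).tendsto 1).mono_left nhdsWithin_le_nhds
  have h2 : ∀ᶠ s : ℝ in 𝓝[>] 1, r * s ^ k < 1 := h1.eventually (gt_mem_nhds (by simpa using hr))
  obtain ⟨s, hs1, hs2⟩ := (h2.and self_mem_nhdsWithin).exists
  exact ⟨s, hs2, hs1⟩

lemma exists_bound_of_isBigO {u : ℕ → ℝ} {s : ℝ} (hs : 0 < s)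
    (h : u =O[atTop] fun n => s ^ n) : ∃ C > 0, ∀ n, |u n| ≤ C * s ^ n := by
  obtain ⟨C, hC, h1⟩ := bound_of_isBigO_nat_atTop h
  refine ⟨C, hC, fun n => ?_⟩
  have h2 := h1 (x := n) (by positivity)
  rwa [Real.norm_eq_abs, Real.norm_of_nonneg (by positivity)] at h2

/-- Geometric domination of the shifted Mehler series, uniform in the first shift. -/
lemma exists_bound_mehlerTerm {q x y s : ℝ} (hq : |q| < 1) (hx : x ∈ S q) (hy : y ∈ S q)
    (hs : 1 < s) (m : ℕ) :
    ∃ C > 0, ∀ n i r, |mehlerTerm x y r q n m i| ≤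
      C * ((s / √(1 - q)) ^ n * (|r| * s ^ 3) ^ i) := by
  have h1 : 0 < 1 - q := by linarith [(abs_lt.1 hq).2]
  have h2 : 0 < √(1 - q) := Real.sqrt_pos.2 h1
  have hs0 : 0 < s := by linarith
  obtain ⟨B, hB, hB'⟩ := exists_bound_of_isBigO (by positivity) (isBigO_qHermite hq hx hs)
  obtain ⟨D, hD, hD'⟩ := exists_bound_of_isBigO (by positivity) (isBigO_qHermite hq hy hs)
  obtain ⟨E, hE, hE'⟩ := exists_bound_of_isBigO (s := s * (1 - q)) (by positivity)
    (isBigO_inv_qFactorial hq (by nlinarith))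
  refine ⟨E * B * D * (s / √(1 - q)) ^ m, by positivity, fun n i r => ?_⟩
  rw [mehlerTerm, div_eq_mul_inv]
  simp only [abs_mul, abs_pow]
  calc _ ≤ |r| ^ i * (E * (s * (1 - q)) ^ i) * (B * (s / √(1 - q)) ^ (i + n)) *
        (D * (s / √(1 - q)) ^ (i + m)) := by
        gcongr
        exacts [hE' i, hB' _, hD' _]
    _ = E * B * D * (s / √(1 - q)) ^ m * ((s / √(1 - q)) ^ n *
          (|r| * (s * (1 - q)) * (s / √(1 - q)) * (s / √(1 - q))) ^ i) := by
        simp only [mul_pow, pow_add]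
        ring
    _ = _ := by
        -- The powers of 1 - q cancel; one factor s remains from each of the three growth bounds.
        have h3 : |r| * (s * (1 - q)) * (s / √(1 - q)) * (s / √(1 - q)) = |r| * s ^ 3 := by
          nth_rewrite 1 [← Real.sq_sqrt h1.le]
          field_simp
        rw [h3]

lemma summable_mehlerTerm {q x y r : ℝ} (hq : |q| < 1) (hx : x ∈ S q) (hy : y ∈ S q)
    (hr : |r| < 1) (n m : ℕ) : Summable (mehlerTerm x y r q n m) := by
  obtain ⟨s, hs, hs'⟩ := exists_one_lt_mul_pow_lt_one hr 3
  obtain ⟨C, -, h⟩ := exists_bound_mehlerTerm hq hx hy hs m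
  exact .of_norm_bounded (((summable_geometric_of_lt_one (by positivity) hs').mul_left _).mul_left C)
    fun i => h n i r

lemma mehlerSum_comm (x y r q : ℝ) (n m : ℕ) : mehlerSum x y r q n m = mehlerSum y x r q m n :=
  tsum_congr fun i => by simp only [mehlerTerm]; ring

lemma mehlerSum_zero (x y q : ℝ) : mehlerSum x y 0 q 0 0 = 1 := by
  rw [mehlerSum, tsum_eq_single 0 fun i hi => by simp [mehlerTerm, hi]]
  simp [mehlerTerm, qHermite, qFactorial_zero]

lemma continuousOn_mehlerSum {q x y : ℝ} (hq : |q| < 1) (hx : x ∈ S q) (hy : y ∈ S q) (n m : ℕ) :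
    ContinuousOn (fun r => mehlerSum x y r q n m) (Set.Ioo (-1) 1) := by
  intro r hr
  obtain ⟨t, ht, ht1⟩ := exists_between (abs_lt.2 hr)
  have ht0 : 0 < t := (abs_nonneg r).trans_lt ht
  obtain ⟨s, hs, hs'⟩ := exists_one_lt_mul_pow_lt_one ht1 3
  obtain ⟨C, hC, h⟩ := exists_bound_mehlerTerm hq hx hy hs m
  have hcont : ContinuousOn (fun r => mehlerSum x y r q n m) (Set.Icc (-t) t) := by
    refine continuousOn_tsum (u := fun i => C * (|s / √(1 - q)| ^ n * (t * s ^ 3) ^ i))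
      (fun i => ?_) (((summable_geometric_of_lt_one (by positivity) hs').mul_left _).mul_left C)
      fun i a ha => (h n i a).trans ?_
    · unfold mehlerTerm
      fun_prop
    · have ha' : |a| ≤ t := abs_le.2 ha
      gcongr
      exact le_abs_self _
  exact (hcont.continuousAt (Icc_mem_nhds (abs_lt.1 ht).1 (abs_lt.1 ht).2)).continuousWithinAt

/-- Summation by shifting the index: the `q`-derivative in the form `[i]_q / [i]_q! = 1 / [i-1]_q!`. -/
lemma hasSum_qNumber_mul {q r a : ℝ} (hq : |q| < 1) {f : ℕ → ℝ}
    (h : HasSum (fun i => r ^ i / qFactorial q i * f (i + 1)) a) :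
    HasSum (fun i => r ^ i / qFactorial q i * (qNumber q i * f i)) (r * a) := by
  rw [← hasSum_nat_add_iff' 1]
  simp only [sum_range_one, qNumber_zero, zero_mul, mul_zero, sub_zero]
  refine (h.mul_left r).congr_fun fun i => ?_
  have := qFactorial_ne_zero hq i
  have := (qNumber_succ_pos hq i).ne'
  rw [qFactorial_succ, pow_succ]
  field_simp

/-- Apply the recurrence to H_{i+n}(x) and split [i+n] = [n] + q^n [i]; the factor [i] shifts the
summation index and so raises the other shift. Truncated indices are harmless because [0] = 0. -/
lemma mehlerSum_succ_left {q x y r : ℝ} (hq : |q| < 1) (hx : x ∈ S q) (hy : y ∈ S q)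
    (hr : |r| < 1) (n m : ℕ) :
    mehlerSum x y r q (n + 1) m = x * mehlerSum x y r q n m
      - qNumber q n * mehlerSum x y r q (n - 1) m - q ^ n * (r * mehlerSum x y r q n (m + 1)) := by
  have hS := fun n m => (summable_mehlerTerm hq hx hy hr n m).hasSum
  have h1 := hasSum_qNumber_mul hq (r := r) (a := mehlerSum x y r q n (m + 1))
    (f := fun i => qHermite x q (i + n - 1) * qHermite y q (i + m)) <| by
      refine (hS n (m + 1)).congr_fun fun i => ?_
      rw [mehlerTerm, add_right_comm, Nat.add_sub_cancel, add_right_comm i 1 m, add_assoc i m 1]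
      ring
  refine (hS (n + 1) m).unique (((((hS n m).mul_left x).sub
    ((hS (n - 1) m).mul_left (qNumber q n))).sub (h1.mul_left (q ^ n))).congr_fun fun i => ?_)
  simp only [mehlerTerm]
  rw [← add_assoc, qHermite_succ, add_comm i n, qNumber_add]
  rcases n with _ | n
  · simp only [qNumber_zero, Nat.zero_sub]
    ring
  · rw [Nat.add_sub_cancel, add_right_comm n 1 i, Nat.add_sub_cancel, add_comm i n]
    ring

lemma mehlerSum_succ_right {q x y r : ℝ} (hq : |q| < 1) (hx : x ∈ S q) (hy : y ∈ S q)
    (hr : |r| < 1) (n : ℕ) :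
    mehlerSum x y r q n 1 = y * mehlerSum x y r q n 0 - r * mehlerSum x y r q (n + 1) 0 := by
  rw [mehlerSum_comm, ← zero_add 1, mehlerSum_succ_left hq hy hx hr 0 n, mehlerSum_comm y x,
    mehlerSum_comm y x r q 0 (n + 1), qNumber_zero]
  ring

lemma abs_sq_lt_one {r : ℝ} (hr : |r| < 1) : |r ^ 2| < 1 := by
  rw [abs_pow]
  exact pow_lt_one₀ (abs_nonneg r) hr two_ne_zero

/-- The shifted Mehler sums are Al-Salam–Chihara polynomials times the Mehler sum. -/
lemma qPochhammer_mul_mehlerSum {q x y r : ℝ} (hq : |q| < 1) (hx : x ∈ S q) (hy : y ∈ S q)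
    (hr : |r| < 1) (n : ℕ) :
    qPochhammer (r ^ 2) q n * mehlerSum x y r q n 0 = P x y r q n * mehlerSum x y r q 0 0 := by
  -- Eliminate the sum with shifts (n, 1) between the two shift relations.
  have hstep : ∀ n, (1 - r ^ 2 * q ^ n) * mehlerSum x y r q (n + 1) 0 =
      (x - r * y * q ^ n) * mehlerSum x y r q n 0
        - qNumber q n * mehlerSum x y r q (n - 1) 0 := fun n => by
    have h1 := mehlerSum_succ_left hq hx hy hr n 0
    rw [zero_add, mehlerSum_succ_right hq hx hy hr n] at h1
    linear_combination h1
  induction n using Nat.twoStepInduction with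
  | zero => simp [qPochhammer, P]
  | one =>
    have h := hstep 0
    simp only [pow_zero, mul_one, qNumber_zero, zero_mul, sub_zero, zero_add] at h
    simp [qPochhammer, P, h]
  | more n ih1 ih2 =>
    have h := hstep (n + 1)
    rw [Nat.add_sub_cancel] at h
    rw [qPochhammer_succ, mul_assoc, h, P]
    rw [qPochhammer_succ] at ih2 ⊢
    linear_combination (x - r * y * q ^ (n + 1)) * ih2
      - (1 - r ^ 2 * q ^ n) * qNumber q (n + 1) * ih1

/-- Termwise, 1 - q^i = (1 - q)[i], and [i] shifts the index. -/
lemma mehlerSum_sub_mehlerSum_mul {q x y r : ℝ} (hq : |q| < 1) (hx : x ∈ S q) (hy : y ∈ S q)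
    (hr : |r| < 1) :
    mehlerSum x y r q 0 0 - mehlerSum x y (r * q) q 0 0 =
      (1 - q) * (r * mehlerSum x y r q 1 1) := by
  have hrq : |r * q| < 1 := by simpa using abs_mul_pow_lt_one hr hq 1
  have h1 := hasSum_qNumber_mul hq (r := r) (a := mehlerSum x y r q 1 1)
    (f := fun i => qHermite x q i * qHermite y q i)
    ((summable_mehlerTerm hq hx hy hr 1 1).hasSum.congr_fun fun i => by rw [mehlerTerm]; ring)
  refine ((summable_mehlerTerm hq hx hy hr 0 0).hasSum.sub
    (summable_mehlerTerm hq hx hy hrq 0 0).hasSum).unique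
    ((h1.mul_left (1 - q)).congr_fun fun i => ?_)
  simp only [mehlerTerm, mul_pow, add_zero]
  linear_combination (-(r ^ i / qFactorial q i * qHermite x q i * qHermite y q i)) *
    one_sub_mul_qNumber q i

/-- A zero of the Mehler sum propagates along `r q ^ k` to `0`, where the sum is `1`. -/
lemma mehlerSum_ne_zero {q x y r : ℝ} (hq : |q| < 1) (hx : x ∈ S q) (hy : y ∈ S q)
    (hr : |r| < 1) : mehlerSum x y r q 0 0 ≠ 0 := by
  intro h0
  have hall : ∀ k, mehlerSum x y (r * q ^ k) q 0 0 = 0 := fun k => by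
    induction k with
    | zero => simpa using h0
    | succ k ih =>
      have hk := abs_mul_pow_lt_one hr hq k
      -- All sums with shifts (n, 0) are multiples of the vanishing one; hence so does the (1, 1)
      -- sum vanish, and the q-difference is zero.
      have hn : ∀ n, mehlerSum x y (r * q ^ k) q n 0 = 0 := fun n => by
        have h := qPochhammer_mul_mehlerSum hq hx hy hk n
        rw [ih, mul_zero] at h
        exact (mul_eq_zero.1 h).resolve_left (qPochhammer_ne_zero (abs_sq_lt_one hk) hq n)
      have h := mehlerSum_sub_mehlerSum_mul hq hx hy hk
      rw [mehlerSum_succ_right hq hx hy hk, hn, hn, hn, mul_assoc r, ← pow_succ] at h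
      linarith
  have hlim : Tendsto (fun k => mehlerSum x y (r * q ^ k) q 0 0) atTop (𝓝 1) := by
    have h1 := (continuousOn_mehlerSum hq hx hy 0 0).continuousAt
      (Ioo_mem_nhds (a := (-1 : ℝ)) (x := 0) (by norm_num) one_pos)
    have h2 := (tendsto_pow_atTop_nhds_zero_of_abs_lt_one hq).const_mul r
    rw [mul_zero] at h2
    have h3 := h1.tendsto.comp h2
    rwa [mehlerSum_zero] at h3
  exact one_ne_zero (tendsto_nhds_unique hlim (by simp [hall]))

lemma mehlerSum_pos {q x y r : ℝ} (hq : |q| < 1) (hx : x ∈ S q) (hy : y ∈ S q)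
    (hr : |r| < 1) : 0 < mehlerSum x y r q 0 0 := by
  by_contra! h
  obtain ⟨t, ht, h0⟩ := isPreconnected_Ioo.intermediate_value (abs_lt.1 hr)
    (⟨by norm_num, one_pos⟩ : (0 : ℝ) ∈ Set.Ioo (-1) 1) (continuousOn_mehlerSum hq hx hy 0 0)
    (show (0 : ℝ) ∈ Set.Icc _ _ from ⟨h, by simp [mehlerSum_zero]⟩)
  exact mehlerSum_ne_zero hq hx hy (abs_lt.2 ht) h0

/-- The Al-Salam–Chihara kernel as a quotient of Mehler sums. -/
theorem hasSum_kernel {q a b x y z : ℝ} (hq : |q| < 1) (ha : |a| < 1) (hb : |b| < 1) (ha0 : a ≠ 0)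
    (hx : x ∈ S q) (hy : y ∈ S q) (hz : z ∈ S q) :
    HasSum (fun n => a ^ n / (qFactorial q n * qPochhammer (b ^ 2) q n)
      * P x y b q n * P z y (b / a) q n) (mehlerSum x z a q 0 0 / mehlerSum x y b q 0 0) := by
  have hF := fun n => qFactorial_ne_zero hq n
  have hM := mehlerSum_ne_zero hq hx hy hb
  set f : ℕ × ℕ → ℝ := fun p =>
    homP z y a b q p.1 / qFactorial q p.1 * mehlerTerm x y b q p.1 0 p.2 with hf
  have hrow : ∀ n, HasSum (fun i => f (n, i)) (mehlerSum x y b q 0 0 *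
      (a ^ n / (qFactorial q n * qPochhammer (b ^ 2) q n) * P x y b q n * P z y (b / a) q n)) :=
    fun n => by
    have h1 := (summable_mehlerTerm hq hx hy hb n 0).hasSum.mul_left
      (homP z y a b q n / qFactorial q n)
    have h2 := qPochhammer_mul_mehlerSum hq hx hy hb n
    have h3 := qPochhammer_ne_zero (abs_sq_lt_one hb) hq n
    have h4 : mehlerSum x y b q 0 0 * (a ^ n / (qFactorial q n * qPochhammer (b ^ 2) q n)
        * P x y b q n * P z y (b / a) q n) =
        homP z y a b q n / qFactorial q n * mehlerSum x y b q n 0 := by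
      have := hF n
      rw [homP_eq_pow_mul ha0]
      field_simp
      linear_combination -(P z y (b / a) q n) * h2
    rw [h4]
    exact h1
  have hdiag : ∀ N, HasSum (fun p : antidiagonal N => f p) (mehlerTerm x z a q 0 0 N) := fun N => by
    convert hasSum_fintype (fun p : antidiagonal N => f p) using 1
    rw [sum_coe_sort (antidiagonal N) f]
    have h1 := sum_antidiagonal_homP_mul_qHermite hq z y a b N
    calc mehlerTerm x z a q 0 0 N = qHermite x q N * (a ^ N * qHermite z q N / qFactorial q N) := by
          simp only [mehlerTerm, add_zero]
          ring
      _ = _ := by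
          rw [← h1, mul_sum]
          refine sum_congr rfl fun p hp => ?_
          rw [← mem_antidiagonal.1 hp, add_comm p.1]
          simp only [hf, mehlerTerm, add_zero]
          ring
  have hsum : Summable f := by
    have hm : max |a| |b| < 1 := max_lt ha hb
    obtain ⟨s, hs, hs'⟩ := exists_one_lt_mul_pow_lt_one hm 3
    have hs0 : 0 < s := by linarith
    have h1 : 0 < 1 - q := by linarith [(abs_lt.1 hq).2]
    have h2 : 0 < √(1 - q) := Real.sqrt_pos.2 h1
    have ha' : 0 < |a| := abs_pos.2 ha0
    obtain ⟨C, hC, hC'⟩ := exists_bound_mehlerTerm hq hx hy hs 0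
    obtain ⟨A, hA, hA'⟩ := exists_bound_of_isBigO (by positivity)
      (isBigO_homP hq hz y b (a := a) (s := |a| * s) (lt_mul_of_one_lt_right ha' hs))
    obtain ⟨E, hE, hE'⟩ := exists_bound_of_isBigO (s := s * (1 - q)) (by positivity)
      (isBigO_inv_qFactorial hq (by nlinarith))
    have hbd : ∀ p : ℕ × ℕ, ‖f p‖ ≤ A * E * C * ((|a| * s ^ 3) ^ p.1 * (|b| * s ^ 3) ^ p.2) := by
      intro p
      simp only [hf, Real.norm_eq_abs, div_eq_mul_inv (homP _ _ _ _ _ _), abs_mul]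
      calc _ ≤ A * (|a| * s / √(1 - q)) ^ p.1 * (E * (s * (1 - q)) ^ p.1) *
            (C * ((s / √(1 - q)) ^ p.1 * (|b| * s ^ 3) ^ p.2)) := by
            gcongr
            exacts [hA' _, hE' _, hC' _ _ _]
        _ = A * E * C * ((|a| * s / √(1 - q) * (s * (1 - q)) * (s / √(1 - q))) ^ p.1 *
            (|b| * s ^ 3) ^ p.2) := by
            simp only [mul_pow]
            ring
        _ = _ := by
            congr 3
            nth_rewrite 2 [← Real.sq_sqrt h1.le]
            field_simp
    refine .of_norm_bounded (Summable.mul_left _ (Summable.mul_of_nonneg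
      (f := fun n => (|a| * s ^ 3) ^ n) (g := fun n => (|b| * s ^ 3) ^ n)
      (summable_geometric_of_lt_one (by positivity) ?_)
      (summable_geometric_of_lt_one (by positivity) ?_)
      (fun n => by positivity) (fun n => by positivity))) hbd
    · exact lt_of_le_of_lt (by gcongr; exact le_max_left _ _) hs'
    · exact lt_of_le_of_lt (by gcongr; exact le_max_right _ _) hs'
  -- Antidiagonal and row summation of the same double series.
  have h1 := (HasAntidiagonal.sigmaAntidiagonalEquivProd.hasSum_iff.2 hsum.hasSum).sigma hdiag
  have h2 := (hsum.hasSum.prod_fiberwise hrow).div_const (mehlerSum x y b q 0 0)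
  rw [← h1.tsum_eq] at h2
  exact h2.congr_fun fun n => by rw [mul_div_cancel_left₀ _ hM]

end ASC

theorem mainTheorem2 (q ρ₁ ρ₂ x y z : ℝ)
    (hq : |q| < 1) (hρ₁ : |ρ₁| < 1) (hρ₂ : |ρ₂| < 1)
    (hρ₁0 : ρ₁ ≠ 0) (hρ₂0 : ρ₂ ≠ 0)
    (hx : x ∈ ASC.S q) (hy : y ∈ ASC.S q) (hz : z ∈ ASC.S q) :
    Summable (fun n : ℕ => ρ₁ ^ n / (ASC.qFactorial q n * ASC.qPochhammer (ρ₂ ^ 2) q n)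
        * ASC.P x y ρ₂ q n * ASC.P z y (ρ₂ / ρ₁) q n) ∧
    Summable (fun n : ℕ => ρ₂ ^ n / (ASC.qFactorial q n * ASC.qPochhammer (ρ₁ ^ 2) q n)
        * ASC.P x z ρ₁ q n * ASC.P y z (ρ₁ / ρ₂) q n) ∧
    0 < ∑' n : ℕ, ρ₁ ^ n / (ASC.qFactorial q n * ASC.qPochhammer (ρ₂ ^ 2) q n)
        * ASC.P x y ρ₂ q n * ASC.P z y (ρ₂ / ρ₁) q n ∧
    1 / (∑' n : ℕ, ρ₁ ^ n / (ASC.qFactorial q n * ASC.qPochhammer (ρ₂ ^ 2) q n)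
        * ASC.P x y ρ₂ q n * ASC.P z y (ρ₂ / ρ₁) q n) =
      ∑' n : ℕ, ρ₂ ^ n / (ASC.qFactorial q n * ASC.qPochhammer (ρ₁ ^ 2) q n)
        * ASC.P x z ρ₁ q n * ASC.P y z (ρ₁ / ρ₂) q n := by
  have h1 := ASC.hasSum_kernel hq hρ₁ hρ₂ hρ₁0 hx hy hz
  have h2 := ASC.hasSum_kernel hq hρ₂ hρ₁ hρ₂0 hx hz hy
  have hxz := ASC.mehlerSum_pos hq hx hz hρ₁
  have hxy := ASC.mehlerSum_pos hq hx hy hρ₂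
  refine ⟨h1.summable, h2.summable, ?_, ?_⟩
  · rw [h1.tsum_eq]
    exact div_pos hxz hxy
  · rw [h1.tsum_eq, h2.tsum_eq, one_div_div]
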